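/- Let $\mathcal G$ be a weighted digraph with nodes $v_1,\dots,v_n$ and adjacency matrix $A=[a_{ij}]$, where $a_{ij}\ge 0$, $a_{ii}=0$, and $a_{ij}>0$ if and only if there is an edge from $v_j$ to $v_i$. Suppose that $\mathcal G$ is a directed spanning tree: one node, the root, has no incoming edge, every other node has exactly one incoming edge, and there is a directed path from the root to every node. Number the edges $1,\dots,n-1$, let $a_k>0$ be the weight of edge $k$, and let $B\in\mathbb R^{n\times(n-1)}$ be the incidence matrix: $B_{ik}=1$ if edge $k$ originates from $v_i$, $B_{ik}=-1$ if edge $k$ is directed towards $v_i$, and $B_{ik}=0$ otherwise. Write $B_{\cdot,k}$ for its $k$-th column. For a map $X:\mathbb R^p\to\mathbb R^q$ let $$\mathcal F[X](x)=\bigcap_{\delta>0}\ \bigcap_{\mu(S)=0}\overline{\mathrm{co}}\,\bigl\{X\bigl(B(x,\delta)\setminus S\bigr)\bigr\}$$ be its Filippov set-valued map ($\mu$ is Lebesgue measure, $B(x,\delta)$ the open ball). A Filippov trajectory of $\dot x=X(x)$, where $X:\mathbb R^n\to\mathbb R^n$, is a function $x:[0,\infty)\to\mathbb R^n$ that is absolutely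 continuous on every $[0,T]$ and satisfies $\dot x(t)\in\mathcal F[X](x(t))$ for almost every $t\ge 0$. Let $\bar g:\mathbb R\to\mathbb R$ be increasing (not necessarily strictly, and not necessarily continuous) with $\lim_{s\to\infty}|\bar g(s)|=\infty$ and $\bar g(0)=0$, and let $g_{ij}=\bar g$ for all $i,j$ with $a_{ij}>0$. Then every Filippov trajectory of the system $$\dot x_i=\sum_{j=1}^n a_{ij}\,g_{ij}(x_j-x_i),\qquad i=1,\dots,n,$$ converges, as $t\to\infty$, to the set $$\mathcal H_3=\Bigl\{x\in\mathbb R^n \ \Big|\ \exists\,\alpha\in\mathcal F[\bar g](0)\ \text{ such that }\ \alpha\mathbf 1_{n-1}\in \prod_{k=1}^{n-1} a_k\,\mathcal F[\bar g]\bigl(B_{\cdot,k}^\top x\bigr)\Bigr\},$$ that is, the distance from $x(t)$ to $\mathcal H_3$ tends to $0$. Likewise, every Filippov trajectory of the system $\dot x_i=-\sum_{j=1}^n a_{ij}\,g_{ij}(x_i-x_j)$, $i=1,\dots,n$, converges to the set obtained from $\mathcal H_3$ by replacing $B$ with $-B$. -/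

import Mathlib

open MeasureTheory Filter Topology
open scoped Pointwise

noncomputable section

/-- The Filippov set-valued map of `X`: the intersection, over all radii `δ > 0` and all Lebesgue
null sets `S`, of the closed convex hulls of `X (B(x, δ) \ S)`. -/
def filippovMap {E F : Type*} [PseudoMetricSpace E] [MeasureSpace E]
    [AddCommGroup F] [Module ℝ F] [TopologicalSpace F] (X : E → F) (x : E) : Set F :=
  ⋂ (δ : ℝ) (_ : 0 < δ) (S : Set E) (_ : volume S = 0),
    closure (convexHull ℝ (X '' (Metric.ball x δ \ S)))

/-- `x` is a Filippov solution of `ẋ = X(x)` on `[0, ∞)`: it is absolutely continuous on every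
compact interval `[0, T]` and satisfies `ẋ(t) ∈ F[X](x(t))` for almost every `t ≥ 0`. -/
def IsFilippovSolution {n : ℕ} (X : EuclideanSpace ℝ (Fin n) → EuclideanSpace ℝ (Fin n))
    (x : ℝ → EuclideanSpace ℝ (Fin n)) : Prop :=
  (∀ T : ℝ, 0 < T → AbsolutelyContinuousOnInterval x 0 T) ∧
    ∀ᵐ t ∂(volume.restrict (Set.Ici (0 : ℝ))), ∃ v ∈ filippovMap X (x t), HasDerivAt x v t

/-- The trajectory `x` converges to the set `H` as `t → ∞`: the distance from `x t` to `H` tends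
to zero (the distance to the empty set being `∞`). -/
def ConvergesToSet {n : ℕ} (x : ℝ → EuclideanSpace ℝ (Fin n))
    (H : Set (EuclideanSpace ℝ (Fin n))) : Prop :=
  Tendsto (fun t => Metric.infEDist (x t) H) atTop (𝓝 0)

/-- The standing assumption on the nonlinearities: increasing (in the wide sense, so that
quantizers are included), with `|f s| → ∞` as `s → ∞`. No continuity is required. -/
structure IsIncreasingUnbounded (f : ℝ → ℝ) : Prop where
  monotone : Monotone f
  tendsto_abs : Tendsto (fun s => |f s|) atTop atTop

/-- A weighted digraph on `n` nodes, given by its weighted adjacency matrix. -/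
structure WeightedDigraph (n : ℕ) where
  /-- The weighted adjacency matrix. -/
  A : Matrix (Fin n) (Fin n) ℝ
  nonneg : ∀ i j, 0 ≤ A i j
  diag : ∀ i, A i i = 0

namespace WeightedDigraph

variable {n : ℕ} (G : WeightedDigraph n)

/-- There is an edge from node `i` to node `j`, i.e. the entry `(j, i)` of `A` is positive. -/
def IsEdge (i j : Fin n) : Prop := 0 < G.A j i

/-- The edges `(i, j)` of the digraph, directed from `i` to `j`. -/
abbrev Edge : Type := {e : Fin n × Fin n // G.IsEdge e.1 e.2}

/-- The weight of the edge from `i` to `j`. -/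
def weight (e : G.Edge) : ℝ := G.A e.1.2 e.1.1

/-- The incidence matrix: the column of an edge has `-1` at the node the edge is directed towards,
`1` at the node it originates from, and `0` elsewhere. -/
def incidence : Matrix (Fin n) G.Edge ℝ :=
  Matrix.of fun i e => if i = e.1.2 then -1 else if i = e.1.1 then 1 else 0

/-- The digraph is a directed spanning tree: there is a root without incoming edges, every other
node has exactly one incoming edge, and there is a directed path from the root to every node. -/
def IsDirectedSpanningTree : Prop :=
  ∃ r : Fin n, (∀ j, ¬ G.IsEdge j r) ∧ (∀ i, i ≠ r → ∃! j, G.IsEdge j i) ∧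
    ∀ i, Relation.ReflTransGen G.IsEdge r i

/-- Right-hand side of the protocol `ẋ_i = ∑_j a_ij g_ij (x_j - x_i)`. -/
def commField (g : Fin n → Fin n → ℝ → ℝ) (x : EuclideanSpace ℝ (Fin n)) :
    EuclideanSpace ℝ (Fin n) :=
  WithLp.toLp 2 fun i => ∑ j, G.A i j * g i j (x j - x i)

/-- Right-hand side of the protocol `ẋ_i = - ∑_j a_ij g_ij (x_i - x_j)`. -/
def negCommField (g : Fin n → Fin n → ℝ → ℝ) (x : EuclideanSpace ℝ (Fin n)) :
    EuclideanSpace ℝ (Fin n) :=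
  WithLp.toLp 2 fun i => -∑ j, G.A i j * g i j (x i - x j)

/-- For an incidence-type matrix `M` with columns `M_e` (either `B` or `-B` below): the set of `x`
for which some `α ∈ F[ḡ](0)` satisfies `α 𝟙 ∈ ∏_e a_e F[ḡ](M_eᵀ x)`. -/
def limitSet (M : Matrix (Fin n) G.Edge ℝ) (gbar : ℝ → ℝ) : Set (EuclideanSpace ℝ (Fin n)) :=
  {x | ∃ α ∈ filippovMap gbar 0, (fun _ : G.Edge => α) ∈
    Set.univ.pi fun e : G.Edge => G.weight e • filippovMap gbar (∑ i, M i e * x i)}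

end WeightedDigraph

end

open Set

/-! ### Filippov maps -/

/-! On a directed spanning tree the dynamics decouple into a cascade. The root is constant, and
every other coordinate `z` follows its unique parent `w` through a scalar inclusion `ż ∈ κ F[f](w -
z)`. If `w` tends to `c`, the sign of `f (c - m)` makes the level `m` eventually a one-way barrier
for `z`; hence `z`, being bounded, cannot oscillate and has a limit `d`
(`IsFollower.exists_tendsto`). A drift bounded away from zero would contradict this convergence, so
`0 ∈ F[f](c - d)` (`IsFollower.zero_mem_filippovMap`). Induction along paths from the root then
shows that the whole trajectory converges to a single point, which lies in the limit set with `α =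
0`. The second protocol is the first with `f` replaced by `s ↦ -f (-s)`. -/

theorem filippovMap_le {E F : Type*} [PseudoMetricSpace E] [MeasureSpace E]
    [AddCommGroup F] [Module ℝ F] [TopologicalSpace F] {X : E → F} {x : E} {v : F}
    (hv : v ∈ filippovMap X x) (L : F →L[ℝ] ℝ) {C : ℝ} (h : ∀ᶠ y in 𝓝 x, L (X y) ≤ C) :
    L v ≤ C := by
  obtain ⟨δ, hδ, hball⟩ := Metric.eventually_nhds_iff_ball.1 h
  have hv' : v ∈ closure (convexHull ℝ (X '' (Metric.ball x δ \ ∅))) := by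
    simp only [filippovMap, mem_iInter] at hv
    exact hv δ hδ ∅ measure_empty
  refine closure_minimal (convexHull_min ?_ ?_) (isClosed_le L.continuous continuous_const) hv'
  · rintro _ ⟨y, hy, rfl⟩
    exact hball y hy.1
  · exact convex_halfSpace_le L.toLinearMap.isLinear C

theorem le_filippovMap {E F : Type*} [PseudoMetricSpace E] [MeasureSpace E]
    [AddCommGroup F] [Module ℝ F] [TopologicalSpace F] [IsTopologicalAddGroup F] {X : E → F} {x : E}
    {v : F} (hv : v ∈ filippovMap X x) (L : F →L[ℝ] ℝ) {C : ℝ}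
    (h : ∀ᶠ y in 𝓝 x, C ≤ L (X y)) : C ≤ L v := by
  have := filippovMap_le hv (-L) (C := -C) (h.mono fun y hy => by simpa using hy)
  simpa using this

/-- A null set contains no interval, so every ball minus `S` keeps a point on each side of `x`.
Their values bracket `v`, which therefore lies on the segment between them. -/
theorem mem_filippovMap_of_bounds {f : ℝ → ℝ} {x v : ℝ} (hr : ∀ s, x < s → v ≤ f s)
    (hl : ∀ s, s < x → f s ≤ v) : v ∈ filippovMap f x := by
  simp only [filippovMap, mem_iInter]
  intro δ hδ S hS
  have key : ∀ a b : ℝ, a < b → ∃ p ∈ Ioo a b, p ∉ S := by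
    intro a b hab
    by_contra! hsub
    have := measure_mono_null (μ := volume) (show Ioo a b ⊆ S from hsub) hS
    simp at this
    linarith
  obtain ⟨p, hp, hpS⟩ := key x (x + δ) (by linarith)
  obtain ⟨q, hq, hqS⟩ := key (x - δ) x (by linarith)
  have hpm : f p ∈ f '' (Metric.ball x δ \ S) :=
    ⟨p, ⟨by rw [Real.ball_eq_Ioo]; exact ⟨by linarith [hp.1], hp.2⟩, hpS⟩, rfl⟩
  have hqm : f q ∈ f '' (Metric.ball x δ \ S) :=
    ⟨q, ⟨by rw [Real.ball_eq_Ioo]; exact ⟨hq.1, by linarith [hq.2]⟩, hqS⟩, rfl⟩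
  have hpq : f q ≤ f p := (hl q hq.2).trans (hr p hp.1)
  refine subset_closure (segment_subset_convexHull hqm hpm ?_)
  rw [segment_eq_Icc hpq]
  exact ⟨hl q hq.2, hr p hp.1⟩

/-! ### Absolutely continuous functions on the half-line -/

theorem AbsolutelyContinuousOnInterval.sub_le_mul {z : ℝ → ℝ} {a b C : ℝ} (hab : a ≤ b)
    (hz : AbsolutelyContinuousOnInterval z a b)
    (hd : ∀ᵐ t, t ∈ Ioo a b → deriv z t ≤ C) : z b - z a ≤ C * (b - a) := by
  rw [← hz.integral_deriv_eq_sub]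
  have hconst : ∫ _ in a..b, C = C * (b - a) := by simp [mul_comm]
  rw [← hconst]
  refine intervalIntegral.integral_mono_ae_restrict hab hz.intervalIntegrable_deriv (by simp) ?_
  rw [Measure.restrict_congr_set Ioo_ae_eq_Icc.symm]
  exact (ae_restrict_iff' measurableSet_Ioo).2 hd

theorem absolutelyContinuousOnInterval_of_forall {z : ℝ → ℝ}
    (hz : ∀ T : ℝ, 0 < T → AbsolutelyContinuousOnInterval z 0 T) {a b : ℝ} (ha : 0 ≤ a)
    (hab : a ≤ b) : AbsolutelyContinuousOnInterval z a b := by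
  refine (hz (b + 1) (by linarith)).mono ?_
  rw [uIcc_of_le hab, uIcc_of_le (by linarith)]
  exact Icc_subset_Icc ha (by linarith)

/-- If `z` does not increase while it is above the level `M`, then it never crosses `M` upwards. -/
theorem le_of_deriv_nonpos_above {z : ℝ → ℝ}
    (hz : ∀ T : ℝ, 0 < T → AbsolutelyContinuousOnInterval z 0 T) {T M : ℝ} (hT : 0 ≤ T)
    (hTM : z T ≤ M) (hd : ∀ᵐ t, T ≤ t → M < z t → deriv z t ≤ 0) :
    ∀ t, T ≤ t → z t ≤ M := by
  intro t ht
  by_contra! hMt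
  have hac := absolutelyContinuousOnInterval_of_forall hz hT ht
  have hcont : ContinuousOn z (Icc T t) := by
    simpa [uIcc_of_le ht] using hac.continuousOn
  let S := Icc T t ∩ z ⁻¹' Iic M
  have hSc : IsClosed S := hcont.preimage_isClosed_of_isClosed isClosed_Icc isClosed_Iic
  have hSb : BddAbove S := ⟨t, fun s hs => hs.1.2⟩
  -- The last time in `[T, t]` at which `z ≤ M`; from there on `z` stays above `M` and so cannot
  -- increase.
  have hm : sSup S ∈ S := hSc.csSup_mem ⟨T, ⟨le_rfl, ht⟩, hTM⟩ hSb
  set m := sSup S with hmdef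
  have hlt : ∀ s ∈ Ioo m t, M < z s := by
    intro s hs
    by_contra! h
    exact absurd (le_csSup hSb (show s ∈ S from ⟨⟨hm.1.1.trans hs.1.le, hs.2.le⟩, h⟩))
      (not_le.2 hs.1)
  have := (absolutelyContinuousOnInterval_of_forall hz (hT.trans hm.1.1) hm.1.2).sub_le_mul hm.1.2
    (C := 0) (hd.mono fun s hs hsm => hs (hm.1.1.trans hsm.1.le) (hlt s hsm))
  have hmM : z m ≤ M := hm.2
  linarith

/-! ### The scalar follower inclusion -/

/-- `z` is a locally absolutely continuous solution on `[0, ∞)` of `ż ∈ κ F[f](w - z)`, where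
membership in `F[f]` is expressed by the one-sided bounds valid for monotone `f`. -/
def IsFollower (κ : ℝ) (f w z : ℝ → ℝ) : Prop :=
  (∀ T : ℝ, 0 < T → AbsolutelyContinuousOnInterval z 0 T) ∧
    ∀ᵐ t, 0 ≤ t → ∃ v, HasDerivAt z (κ * v) t ∧
      (∀ s, w t - z t < s → v ≤ f s) ∧ ∀ s, s < w t - z t → f s ≤ v

namespace IsFollower

variable {κ : ℝ} {f w z : ℝ → ℝ}

/-- This symmetry turns each upper estimate below into the matching lower one. -/
theorem reflect (h : IsFollower κ f w z) :
    IsFollower κ (fun s => -f (-s)) (fun t => -w t) (fun t => -z t) := by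
  refine ⟨fun T hT => (h.1 T hT).neg, h.2.mono fun t ht h0 => ?_⟩
  obtain ⟨v, hv, hr, hl⟩ := ht h0
  refine ⟨-v, by rw [mul_neg]; exact hv.neg, fun s hs => ?_, fun s hs => ?_⟩
  · exact neg_le_neg (hl _ (by linarith))
  · exact neg_le_neg (hr _ (by linarith))

theorem deriv_le (h : IsFollower κ f w z) (hκ : 0 < κ) :
    ∀ᵐ t, 0 ≤ t → ∀ s, w t - z t < s → deriv z t ≤ κ * f s := by
  refine h.2.mono fun t ht h0 s hs => ?_
  obtain ⟨v, hv, hr, -⟩ := ht h0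
  rw [hv.deriv]
  exact mul_le_mul_of_nonneg_left (hr s hs) hκ.le

theorem isBoundedUnder_le (h : IsFollower κ f w z) (hκ : 0 < κ) (hf0 : f 0 = 0) {c : ℝ}
    (hw : Tendsto w atTop (𝓝 c)) : atTop.IsBoundedUnder (· ≤ ·) z := by
  obtain ⟨T, hT0, hT⟩ := ((eventually_ge_atTop (0 : ℝ)).and (eventually_forall_ge_atTop.2
    (hw.eventually (gt_mem_nhds (show c < c + 1 by linarith))))).exists
  refine ⟨max (z T) (c + 1), eventually_map.2 ((eventually_ge_atTop T).mono ?_)⟩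
  refine le_of_deriv_nonpos_above h.1 hT0 (le_max_left _ _) ((h.deriv_le hκ).mono ?_)
  intro t ht hTt hMt
  have h1 := hT t hTt
  have h2 := (le_max_right (z T) (c + 1)).trans_lt hMt
  simpa [hf0] using ht (hT0.trans hTt) 0 (by linarith)

/-- No upward crossing of `[a, b]` at late times if the drift is nonpositive at a level `m` in
between. -/
theorem not_frequently_crossing (h : IsFollower κ f w z) (hκ : 0 < κ) {c : ℝ}
    (hw : Tendsto w atTop (𝓝 c)) {a m b : ℝ} (ham : a < m) (hmb : m < b) (hfm : f (c - m) ≤ 0) :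
    ¬ ((∃ᶠ t in atTop, z t < a) ∧ ∃ᶠ t in atTop, b < z t) := by
  rintro ⟨hlow, hhigh⟩
  have hev := (eventually_ge_atTop (0 : ℝ)).and (eventually_forall_ge_atTop.2
    (hw.eventually (gt_mem_nhds (show c < c + (b - m) by linarith))))
  obtain ⟨T, hTa, hT0, hT⟩ := (hlow.and_eventually hev).exists
  -- After `T`, `w < c + (b - m)`, so `z > b` forces `w - z < c - m`, where the drift is at most `κ
  -- * f (c - m) ≤ 0`.
  have hle := le_of_deriv_nonpos_above h.1 hT0 (M := b) (by linarith) ((h.deriv_le hκ).mono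
    fun t ht hTt hbt => (ht (hT0.trans hTt) (c - m) (by linarith [hT t hTt])).trans
      (mul_nonpos_of_nonneg_of_nonpos hκ.le hfm))
  obtain ⟨t, hbt, hTt⟩ := (hhigh.and_eventually (eventually_ge_atTop T)).exists
  exact absurd (hle t hTt) (not_le.2 hbt)

theorem exists_tendsto (h : IsFollower κ f w z) (hκ : 0 < κ) (hf0 : f 0 = 0) {c : ℝ}
    (hw : Tendsto w atTop (𝓝 c)) : ∃ d, Tendsto z atTop (𝓝 d) := by
  refine tendsto_of_no_upcrossings dense_univ (fun a _ b _ hab => ?_)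
    (h.isBoundedUnder_le hκ hf0 hw) ?_
  -- At the midpoint `m`, either `f (c - m) ≤ 0` blocks late upcrossings of `[a, b]`, or `f (c - m)
  -- ≥ 0` blocks late downcrossings.
  · rcases le_total (f (c - (a + b) / 2)) 0 with hm | hm
    · exact h.not_frequently_crossing hκ hw (by linarith) (by linarith) hm
    · rintro ⟨hlow, hhigh⟩
      refine h.reflect.not_frequently_crossing hκ hw.neg (a := -b) (m := -((a + b) / 2)) (b := -a)
        (by linarith) (by linarith) ?_
        ⟨hhigh.mono fun t ht => by simpa using ht, hlow.mono fun t ht => by simpa using ht⟩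
      rw [show -(-c - -((a + b) / 2)) = c - (a + b) / 2 by ring]
      linarith
  · obtain ⟨M, hM⟩ := h.reflect.isBoundedUnder_le hκ (by simp [hf0]) hw.neg
    refine ⟨-M, eventually_map.2 ((eventually_map.1 hM).mono fun t ht => ?_)⟩
    exact neg_le.1 ht

theorem nonneg_of_tendsto (h : IsFollower κ f w z) (hκ : 0 < κ) {c d : ℝ}
    (hw : Tendsto w atTop (𝓝 c)) (hz : Tendsto z atTop (𝓝 d)) {s : ℝ} (hs : c - d < s) :
    0 ≤ f s := by
  by_contra! hneg
  obtain ⟨T, hT0, hT, hTd⟩ := ((eventually_ge_atTop (0 : ℝ)).and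
    ((eventually_forall_ge_atTop.2 ((hw.sub hz).eventually (gt_mem_nhds hs))).and
      (eventually_forall_ge_atTop.2 (hz.eventually (Metric.ball_mem_nhds d one_pos))))).exists
  have hC : κ * f s < 0 := mul_neg_of_pos_of_neg hκ hneg
  -- With slope at most `κ * f s`, `z` falls by at least 2 over time `τ`, yet both endpoint values
  -- lie within 1 of `d`.
  set τ := 2 / -(κ * f s) with hτ
  have hτ0 : 0 < τ := div_pos two_pos (by linarith)
  have hle := (absolutelyContinuousOnInterval_of_forall h.1 hT0
    (le_add_of_nonneg_right hτ0.le : T ≤ T + τ)).sub_le_mul (by linarith) (C := κ * f s)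
    ((h.deriv_le hκ).mono fun t ht htm => ht (hT0.trans htm.1.le) s (hT t htm.1.le))
  have hmul : κ * f s * (T + τ - T) = -2 := by
    rw [hτ, add_sub_cancel_left, div_neg, mul_neg, mul_div_cancel₀ _ hC.ne]
  have h1 := hTd T le_rfl
  have h2 := hTd (T + τ) (by linarith)
  rw [Real.dist_eq, abs_lt] at h1 h2
  linarith [h1.2, h2.1]

theorem zero_mem_filippovMap (h : IsFollower κ f w z) (hκ : 0 < κ) {c d : ℝ}
    (hw : Tendsto w atTop (𝓝 c)) (hz : Tendsto z atTop (𝓝 d)) :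
    0 ∈ filippovMap f (c - d) := by
  refine mem_filippovMap_of_bounds (fun s hs => h.nonneg_of_tendsto hκ hw hz hs) fun s hs => ?_
  have := h.reflect.nonneg_of_tendsto hκ hw.neg hz.neg (s := -s) (by linarith)
  simpa using this

end IsFollower

/-! ### Trajectories on a directed spanning tree -/

theorem AbsolutelyContinuousOnInterval.euclideanSpace_apply {ι : Type*} [Fintype ι]
    {x : ℝ → EuclideanSpace ℝ ι} {a b : ℝ} (hx : AbsolutelyContinuousOnInterval x a b) (i : ι) :
    AbsolutelyContinuousOnInterval (fun t => x t i) a b := by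
  refine squeeze_zero (fun _ => Finset.sum_nonneg fun _ _ => dist_nonneg) (fun I => ?_) hx
  refine Finset.sum_le_sum fun k _ => ?_
  rw [dist_eq_norm, dist_eq_norm]
  exact PiLp.norm_apply_le (x (I.2 k).1 - x (I.2 k).2) i

theorem EuclideanSpace.hasDerivAt_apply {ι : Type*} [Fintype ι] {x : ℝ → EuclideanSpace ℝ ι}
    {v : EuclideanSpace ℝ ι} {t : ℝ} (h : HasDerivAt x v t) (i : ι) :
    HasDerivAt (fun t => x t i) (v i) t :=
  (EuclideanSpace.proj (𝕜 := ℝ) i).hasFDerivAt.comp_hasDerivAt t h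

namespace WeightedDigraph

variable {n : ℕ} {G : WeightedDigraph n}

theorem A_eq_zero_of_not_isEdge {i j : Fin n} (h : ¬ G.IsEdge j i) : G.A i j = 0 :=
  le_antisymm (not_lt.1 h) (G.nonneg i j)

theorem sum_incidence_mul (e : G.Edge) (x : EuclideanSpace ℝ (Fin n)) :
    ∑ i, G.incidence i e * x i = x e.1.1 - x e.1.2 := by
  -- The zero diagonal excludes self-loops, so the column really has two nonzero entries.
  have hne : e.1.1 ≠ e.1.2 := fun h => by
    have := e.2
    simp [IsEdge, h, G.diag] at this
  have h : ∀ i, G.incidence i e * x i =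
      (if i = e.1.1 then x i else 0) - if i = e.1.2 then x i else 0 := by
    intro i
    by_cases h2 : i = e.1.2
    · simp [incidence, h2, hne.symm]
    · simp [incidence, h2]
  simp [h, Finset.sum_sub_distrib]

theorem negCommField_eq_commField (g : Fin n → Fin n → ℝ → ℝ) :
    G.negCommField g = G.commField fun i j s => -g i j (-s) := by
  funext x
  simp [negCommField, commField]

variable {g : Fin n → Fin n → ℝ → ℝ} {f : ℝ → ℝ} {x : ℝ → EuclideanSpace ℝ (Fin n)}

theorem commField_apply_of_unique {i j : Fin n}
    (huniq : ∀ k, G.IsEdge k i → k = j) (hg : g i j = f) (y : EuclideanSpace ℝ (Fin n)) :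
    G.commField g y i = G.A i j * f (y j - y i) := by
  simp only [commField]
  rw [Finset.sum_eq_single j, hg]
  · intro k _ hk
    rw [A_eq_zero_of_not_isEdge fun h => hk (huniq k h), zero_mul]
  · simp

/-- With a single parent, coordinate `i` of the field is `G.A i j * f (y j - y i)`. Near `x t` the
difference stays on its side of `s`, so monotonicity bounds the values, and the bounds pass to the
Filippov set. -/
theorem isFollower_of_isFilippovSolution (hf : Monotone f)
    (hx : IsFilippovSolution (G.commField g) x) {i j : Fin n} (hij : G.IsEdge j i)
    (huniq : ∀ k, G.IsEdge k i → k = j) (hg : g i j = f) :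
    IsFollower (G.A i j) f (fun t => x t j) (fun t => x t i) := by
  have hκ : 0 < G.A i j := hij
  refine ⟨fun T hT => (hx.1 T hT).euclideanSpace_apply i, ?_⟩
  refine ((ae_restrict_iff' measurableSet_Ici).1 hx.2).mono fun t ht h0 => ?_
  obtain ⟨v, hv, hd⟩ := ht h0
  have hcont : Continuous fun y : EuclideanSpace ℝ (Fin n) => y j - y i := by fun_prop
  refine ⟨v i / G.A i j, ?_, fun s hs => ?_, fun s hs => ?_⟩
  · rw [mul_div_cancel₀ _ hκ.ne']
    exact EuclideanSpace.hasDerivAt_apply hd i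
  · rw [div_le_iff₀' hκ]
    refine filippovMap_le hv (EuclideanSpace.proj (𝕜 := ℝ) i) ?_
    filter_upwards [hcont.continuousAt.eventually (gt_mem_nhds hs)] with y hy
    change G.commField g y i ≤ _
    rw [commField_apply_of_unique huniq hg]
    exact mul_le_mul_of_nonneg_left (hf hy.le) hκ.le
  · rw [le_div_iff₀' hκ]
    refine le_filippovMap hv (EuclideanSpace.proj (𝕜 := ℝ) i) ?_
    filter_upwards [hcont.continuousAt.eventually (lt_mem_nhds hs)] with y hy
    change _ ≤ G.commField g y i
    rw [commField_apply_of_unique huniq hg]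
    exact mul_le_mul_of_nonneg_left (hf hy.le) hκ.le

theorem root_constant (hx : IsFilippovSolution (G.commField g) x) {r : Fin n}
    (hr : ∀ j, ¬ G.IsEdge j r) {t : ℝ} (ht : 0 ≤ t) : x t r = x 0 r := by
  have hX : ∀ y, G.commField g y r = 0 := fun y => by
    simp [commField, A_eq_zero_of_not_isEdge (hr _)]
  have hac := absolutelyContinuousOnInterval_of_forall
    (fun T hT => (hx.1 T hT).euclideanSpace_apply r) le_rfl ht
  have hd : ∀ᵐ s, 0 ≤ s → deriv (fun t => x t r) s = 0 := by
    refine ((ae_restrict_iff' measurableSet_Ici).1 hx.2).mono fun s hs h0 => ?_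
    obtain ⟨v, hv, hvd⟩ := hs h0
    rw [(EuclideanSpace.hasDerivAt_apply hvd r).deriv]
    exact le_antisymm
      (filippovMap_le hv (EuclideanSpace.proj (𝕜 := ℝ) r) (.of_forall fun y => (hX y).le))
      (le_filippovMap hv (EuclideanSpace.proj (𝕜 := ℝ) r) (.of_forall fun y => (hX y).ge))
  have h1 := hac.sub_le_mul ht (C := 0) (hd.mono fun s hs hm => (hs hm.1.le).le)
  have h2 := hac.neg.sub_le_mul ht (C := 0) (hd.mono fun s hs hm => by
    rw [deriv.neg, hs hm.1.le, neg_zero])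
  simp only [Pi.neg_apply] at h2
  linarith

/-- On a directed spanning tree every trajectory converges to a point at which `0` is an admissible
value of the nonlinearity on each edge. -/
theorem exists_tendsto_of_isDirectedSpanningTree (hG : G.IsDirectedSpanningTree)
    (hf : Monotone f) (hf0 : f 0 = 0) (hg : ∀ i j, G.IsEdge j i → g i j = f)
    (hx : IsFilippovSolution (G.commField g) x) :
    ∃ y, Tendsto x atTop (𝓝 y) ∧ ∀ i j, G.IsEdge j i → 0 ∈ filippovMap f (y j - y i) := by
  obtain ⟨r, hr, hpar, hreach⟩ := hG
  have hfol : ∀ i j, G.IsEdge j i →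
      IsFollower (G.A i j) f (fun t => x t j) (fun t => x t i) := by
    intro i j hij
    have hir : i ≠ r := fun h => hr j (h ▸ hij)
    exact isFollower_of_isFilippovSolution hf hx hij
      (fun k hk => (hpar i hir).unique hk hij) (hg i j hij)
  have hlim : ∀ i, ∃ c, Tendsto (fun t => x t i) atTop (𝓝 c) := by
    intro i
    induction hreach i with
    | refl =>
      refine ⟨x 0 r, tendsto_const_nhds.congr' ?_⟩
      filter_upwards [eventually_ge_atTop 0] with t ht using (root_constant hx hr ht).symm
    | tail _ hij ih =>
      obtain ⟨c, hc⟩ := ih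
      exact (hfol _ _ hij).exists_tendsto hij hf0 hc
  choose c hc using hlim
  refine ⟨WithLp.toLp 2 c, ?_, fun i j hij =>
    (hfol i j hij).zero_mem_filippovMap hij (hc j) (hc i)⟩
  exact (PiLp.continuous_toLp 2 _).continuousAt.tendsto.comp (tendsto_pi_nhds.2 hc)

theorem convergesToSet_of_tendsto {H : Set (EuclideanSpace ℝ (Fin n))}
    {y : EuclideanSpace ℝ (Fin n)} (hx : Tendsto x atTop (𝓝 y)) (hy : y ∈ H) :
    ConvergesToSet x H :=
  tendsto_of_tendsto_of_tendsto_of_le_of_le tendsto_const_nhds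
    (tendsto_iff_edist_tendsto_0.1 hx) (fun _ => zero_le)
    fun _ => Metric.infEDist_le_edist_of_mem hy

theorem mem_limitSet_of_zero_mem {M : Matrix (Fin n) G.Edge ℝ} {y : EuclideanSpace ℝ (Fin n)}
    (h0 : 0 ∈ filippovMap f 0) (h : ∀ e, 0 ∈ filippovMap f (∑ i, M i e * y i)) :
    y ∈ G.limitSet M f :=
  ⟨0, h0, fun e _ => ⟨0, h e, smul_zero _⟩⟩

end WeightedDigraph

theorem zero_mem_filippovMap_zero {f : ℝ → ℝ} (hf : Monotone f) (hf0 : f 0 = 0) :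
    0 ∈ filippovMap f 0 :=
  mem_filippovMap_of_bounds (fun _ hs => hf0.symm.le.trans (hf hs.le))
    fun _ hs => (hf hs.le).trans hf0.le

/-- The Filippov map of a monotone function under the reflection `s ↦ -f (-s)`. -/
theorem zero_mem_filippovMap_neg {f : ℝ → ℝ} (hf : Monotone f) {s : ℝ}
    (h : 0 ∈ filippovMap (fun s => -f (-s)) s) : 0 ∈ filippovMap f (-s) := by
  refine mem_filippovMap_of_bounds (fun u hu => ?_) fun u hu => ?_
  · refine neg_nonpos.1 (le_filippovMap h (ContinuousLinearMap.id ℝ ℝ) ?_)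
    -- Near `s` the reflected values `-f (-y)` are at least `-f u`, hence so is `0`.
    filter_upwards [lt_mem_nhds (show -u < s by linarith)] with y hy
    exact neg_le_neg (hf (by linarith))
  · refine neg_nonneg.1 (filippovMap_le h (ContinuousLinearMap.id ℝ ℝ) ?_)
    filter_upwards [gt_mem_nhds (show s < -u by linarith)] with y hy
    exact neg_le_neg (hf (by linarith))

theorem mainTheorem5 {n : ℕ} (G : WeightedDigraph n) (hG : G.IsDirectedSpanningTree)
    (gbar : ℝ → ℝ) (hgbar : IsIncreasingUnbounded gbar) (hzero : gbar 0 = 0)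
    (g : Fin n → Fin n → ℝ → ℝ) (hg : ∀ i j, G.IsEdge j i → g i j = gbar) :
    (∀ x : ℝ → EuclideanSpace ℝ (Fin n), IsFilippovSolution (G.commField g) x →
      ConvergesToSet x (G.limitSet G.incidence gbar)) ∧
    (∀ x : ℝ → EuclideanSpace ℝ (Fin n), IsFilippovSolution (G.negCommField g) x →
      ConvergesToSet x (G.limitSet (-G.incidence) gbar)) := by
  have h0 := zero_mem_filippovMap_zero hgbar.monotone hzero
  constructor
  · intro x hx
    obtain ⟨y, hy, hmem⟩ := WeightedDigraph.exists_tendsto_of_isDirectedSpanningTree hG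
      hgbar.monotone hzero hg hx
    refine WeightedDigraph.convergesToSet_of_tendsto hy
      (WeightedDigraph.mem_limitSet_of_zero_mem h0 fun e => ?_)
    rw [WeightedDigraph.sum_incidence_mul]
    exact hmem _ _ e.2
  · intro x hx
    rw [WeightedDigraph.negCommField_eq_commField] at hx
    obtain ⟨y, hy, hmem⟩ := WeightedDigraph.exists_tendsto_of_isDirectedSpanningTree hG
      (f := fun s => -gbar (-s)) (fun a b hab => neg_le_neg (hgbar.monotone (neg_le_neg hab)))
      (by simp [hzero]) (fun i j hij => by rw [hg i j hij]) hx
    refine WeightedDigraph.convergesToSet_of_tendsto hy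
      (WeightedDigraph.mem_limitSet_of_zero_mem h0 fun e => ?_)
    simp only [Matrix.neg_apply, neg_mul, Finset.sum_neg_distrib]
    rw [WeightedDigraph.sum_incidence_mul]
    exact zero_mem_filippovMap_neg hgbar.monotone (hmem _ _ e.2)
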